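/- Let $q$ be a complex number with $0<|q|<1$. For $x\in\mathbb{C}$ and an integer $n\ge 0$ put \[(x;q)_\infty=\prod_{i=0}^{\infty}(1-xq^i),\qquad (x;q)_n=\prod_{i=0}^{n-1}(1-xq^i),\] and write $(x_1,\dots,x_r;q)_n=(x_1;q)_n\cdots(x_r;q)_n$, also for $n=\infty$. For an integer $m\ge 2$ define \[P_m(a,b)=(q,a,b;q)_{\infty}\sum_{n=0}^{\infty}\frac{(ab/q^m;q)_{2n}}{(q,a,b,ab/q^m;q)_n}q^n,\] \[Q_m(b)=\sum_{i=0}^{m-2}\frac{(q^{2-m};q)_i}{(q;q)_i\,(bq^i;q)_{m-1}}(1-bq^{2i})\,b^{2i}q^{(2i-2+m)i},\] \[A(a,b)=(q,a,b;q)_{\infty}\sum_{n=0}^{\infty}\frac{(ab/q;q)_{2n}}{(q,a,b,ab/q;q)_n}q^n.\] Then for every integer $m\ge2$ and all complex numbers $a$ and $b$, \[\left(\sum_{k=0}^{m-1}\frac{(q^{m-k};q)_k}{(q;q)_k}(aq^{k-m+1})^kP_m(aq^k,bq^k)\right) \left(\sum_{k=0}^{m-1}\frac{(q^{m-k};q)_k}{(q;q)_k}(bq^{k-m+1})^kP_m(aq^k,bq^k)\right)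 =Q_m(aq^{1-m})\,Q_m(bq^{1-m})\,A(a,b).\] Precisely: whenever none of the denominators occurring in $P_m(a,b)$, $Q_m(aq^{1-m})$ and $Q_m(bq^{1-m})$ vanishes (then those in $P_m(aq^k,bq^k)$, $0\le k\le m-1$, and in $A(a,b)$ do not vanish either), all the series converge absolutely and the identity holds as written. Moreover, the functions $P_m$ and $A$, initially defined where their denominators do not vanish, extend continuously to $\mathbb{C}^2$, the function $Q_m$ extends continuously to $\mathbb{C}$, and with these (unique) extensions the identity holds for all $a,b\in\mathbb{C}$. -/

import Mathlib

open scoped BigOperators Topology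

namespace PartialTheta

/-- The infinite `q`-shifted factorial `(x;q)_∞ = ∏_{i ≥ 0} (1 - x q^i)`. -/
noncomputable def qPochInf (q x : ℂ) : ℂ := ∏' i : ℕ, (1 - x * q ^ i)

/-- The finite `q`-shifted factorial `(x;q)_n = ∏_{i < n} (1 - x q^i)`. -/
noncomputable def qPoch (q x : ℂ) (n : ℕ) : ℂ := ∏ i ∈ Finset.range n, (1 - x * q ^ i)

/-- The infinite product defining `(x;q)_∞` converges for `|q| < 1`. -/
theorem multipliable_qPochInf {q : ℂ} (hq : ‖q‖ < 1) (x : ℂ) :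
    Multipliable fun i : ℕ => 1 - x * q ^ i := by
  have h : Summable fun i : ℕ => ‖-(x * q ^ i)‖ := by
    simp only [norm_neg, norm_mul, norm_pow]
    exact (summable_geometric_of_lt_one (norm_nonneg q) hq).mul_left _
  simpa [sub_eq_add_neg] using multipliable_one_add_of_summable h

/-- `(x;q)_n (x q^n;q)_∞ = (x;q)_∞`, that is `(x;q)_n = (x;q)_∞ / (x q^n;q)_∞` whenever the
quotient makes sense. -/
theorem qPoch_mul_qPochInf {q : ℂ} (hq : ‖q‖ < 1) (x : ℂ) (n : ℕ) :
    qPoch q x n * qPochInf q (x * q ^ n) = qPochInf q x := by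
  have h := multipliable_qPochInf hq (x * q ^ n)
  have h' : Multipliable fun i : ℕ => 1 - x * q ^ (i + n) := by
    refine h.congr fun i => ?_
    ring
  have key := Multipliable.prod_mul_tprod_nat_mul' (f := fun i : ℕ => 1 - x * q ^ i) h'
  rw [qPoch, qPochInf, qPochInf, ← key]
  congr 1
  refine tprod_congr fun i => ?_
  ring

/-- The `n`-th term `(ab/q^m;q)_{2n} q^n / (q, a, b, ab/q^m;q)_n`. -/
noncomputable def term (q : ℂ) (m : ℕ) (a b : ℂ) (n : ℕ) : ℂ :=
  qPoch q (a * b / q ^ m) (2 * n) /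
    (qPoch q q n * qPoch q a n * qPoch q b n * qPoch q (a * b / q ^ m) n) * q ^ n

/-- `P_m(a,b) = (q,a,b;q)_∞ ∑_{n ≥ 0} (ab/q^m;q)_{2n} q^n / (q, a, b, ab/q^m;q)_n`. -/
noncomputable def P (q : ℂ) (m : ℕ) (a b : ℂ) : ℂ :=
  qPochInf q q * qPochInf q a * qPochInf q b * ∑' n : ℕ, term q m a b n

/-- The `n`-th term `(ab/q;q)_{2n} q^n / (q, a, b, ab/q;q)_n` of the Andrews-Warnaar series. -/
noncomputable def awTerm (q a b : ℂ) (n : ℕ) : ℂ :=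
  qPoch q (a * b / q) (2 * n) /
    (qPoch q q n * qPoch q a n * qPoch q b n * qPoch q (a * b / q) n) * q ^ n

/-- The Andrews-Warnaar series
`(q,a,b;q)_∞ ∑_{n ≥ 0} (ab/q;q)_{2n} q^n / (q, a, b, ab/q;q)_n`. -/
noncomputable def AW (q a b : ℂ) : ℂ :=
  qPochInf q q * qPochInf q a * qPochInf q b * ∑' n : ℕ, awTerm q a b n

/-- `Q_m(b) = ∑_{i=0}^{m-2} (q^{2-m};q)_i / ((q;q)_i (b q^i;q)_{m-1})
  (1 - b q^{2i}) b^{2i} q^{(2i-2+m) i}`, for `m ≥ 2`. -/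
noncomputable def Q (q : ℂ) (m : ℕ) (b : ℂ) : ℂ :=
  ∑ i ∈ Finset.range (m - 1),
    qPoch q (q ^ ((2 : ℤ) - m)) i / (qPoch q q i * qPoch q (b * q ^ i) (m - 1)) *
      (1 - b * q ^ (2 * i)) * b ^ (2 * i) * q ^ ((2 * (i : ℤ) - 2 + m) * i)

/-- The coefficient `(q^{m-k};q)_k / (q;q)_k (x q^{k-m+1})^k`. -/
noncomputable def coeff (q : ℂ) (m : ℕ) (x : ℂ) (k : ℕ) : ℂ :=
  qPoch q (q ^ ((m : ℤ) - k)) k / qPoch q q k * (x * q ^ ((k : ℤ) - m + 1)) ^ k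

/-- No denominator in the series with parameters `a`, `b`, `ab/q^m` vanishes. -/
def SeriesRegular (q : ℂ) (m : ℕ) (a b : ℂ) : Prop :=
  ∀ j : ℕ, a * q ^ j ≠ 1 ∧ b * q ^ j ≠ 1 ∧ a * b / q ^ m * q ^ j ≠ 1

/-- No denominator `(b q^i;q)_{m-1}`, `0 ≤ i ≤ m - 2`, in `Q_m(b)` vanishes: the factors of these
products are `1 - b q^j` with `0 ≤ j ≤ 2m - 4`. -/
def QRegular (q : ℂ) (m : ℕ) (b : ℂ) : Prop :=
  ∀ j : ℕ, j + 4 ≤ 2 * m → b * q ^ j ≠ 1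

end PartialTheta

namespace PartialTheta

/-! Let S be the operator (Sφ)(a) = -a φ(aq), and let K_r be the function `kernelSum q r`, which
satisfies (S;q)_{r+1} K_r = 1. Clearing denominators in P_m, expanding by the finite q-binomial
theorem and Euler's theorem, and collecting powers of b gives, with c = q^{-m}, P_m(a,b) = ∑_J
(-b)^J q^{J(J-1)/2} ((cq²S;q)_J K_J)(a) (`hasSum_expansion`).

For A one has c = 1/q, and (qS;q)_J K_J = K_0 for every J. Hence A(a,b) = K_0(a) θ(b) with θ the
partial theta function; symmetry in a and b forces K_0 = θ (`extP_inv_eq`).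

For m = N + 2 one has cq² = q^{-N}. Replacing b by bq^k multiplies the J-th coefficient by q^{kJ},
so the weighted sum over k in the first factor applies (q^{J-N}S;q)_{N+1} to it. The result is
(q^{-N}S;q)_N (S;q)_{J+1} K_J = (q^{-N}S;q)_N 1, a polynomial in a independent of J. Each factor on
the left is therefore a Stieltjes-Wigert polynomial times a partial theta function
(`sum_coeff_mul_extP`), and the two theta functions multiply to A.

Finally Q_m is that same polynomial: iterate the Bailey lemma twice, starting from the unit Bailey
pair (`Q_eq_stieltjesWigert`). -/

theorem qPoch_zero (q x : ℂ) : qPoch q x 0 = 1 := by simp [qPoch]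

theorem qPoch_succ (q x : ℂ) (n : ℕ) : qPoch q x (n + 1) = qPoch q x n * (1 - x * q ^ n) := by
  simp [qPoch, Finset.prod_range_succ]

theorem qPoch_add (q x : ℂ) (m n : ℕ) :
    qPoch q x (m + n) = qPoch q x m * qPoch q (x * q ^ m) n := by
  simp only [qPoch, Finset.prod_range_add]
  congr 1
  exact Finset.prod_congr rfl fun i _ => by ring

theorem qPoch_succ_left (q x : ℂ) (n : ℕ) :
    qPoch q x (n + 1) = (1 - x) * qPoch q (x * q) n := by
  rw [add_comm, qPoch_add]
  simp [qPoch]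

theorem qPoch_ne_zero {q x : ℂ} {n : ℕ} (h : ∀ i < n, x * q ^ i ≠ 1) : qPoch q x n ≠ 0 :=
  Finset.prod_ne_zero_iff.2 fun i hi => sub_ne_zero.2 (h i (Finset.mem_range.1 hi)).symm

theorem one_sub_pow_ne_zero {q : ℂ} (hq : ‖q‖ < 1) {n : ℕ} (hn : n ≠ 0) : 1 - q ^ n ≠ 0 := by
  intro h
  have h1 : ‖q ^ n‖ < 1 := by
    rw [norm_pow]
    exact pow_lt_one₀ (norm_nonneg q) hq hn
  rw [← sub_eq_zero.1 h] at h1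
  simp at h1

theorem qPoch_self_succ (q : ℂ) (n : ℕ) :
    qPoch q q (n + 1) = qPoch q q n * (1 - q ^ (n + 1)) := by
  rw [qPoch_succ, pow_succ']

theorem qPoch_self_ne_zero {q : ℂ} (hq : ‖q‖ < 1) (n : ℕ) : qPoch q q n ≠ 0 := by
  induction n with
  | zero => simp [qPoch_zero]
  | succ n ih =>
    rw [qPoch_self_succ]
    exact mul_ne_zero ih (one_sub_pow_ne_zero hq n.succ_ne_zero)

/-! ### Gaussian binomials and the finite q-binomial theorem -/

/-- The Gaussian binomial coefficient, defined by Pascal's rule. -/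
noncomputable def gauss (q : ℂ) : ℕ → ℕ → ℂ
  | _, 0 => 1
  | 0, _ + 1 => 0
  | n + 1, k + 1 => gauss q n (k + 1) * q ^ (k + 1) + gauss q n k

theorem gauss_zero_right (q : ℂ) (n : ℕ) : gauss q n 0 = 1 := by cases n <;> rfl

theorem gauss_succ_succ (q : ℂ) (n k : ℕ) :
    gauss q (n + 1) (k + 1) = gauss q n (k + 1) * q ^ (k + 1) + gauss q n k := rfl

theorem gauss_eq_zero_of_lt (q : ℂ) {n k : ℕ} (h : n < k) : gauss q n k = 0 := by
  induction n generalizing k with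
  | zero =>
    obtain ⟨k, rfl⟩ := Nat.exists_eq_succ_of_ne_zero h.ne'
    rfl
  | succ n ih =>
    obtain ⟨k, rfl⟩ := Nat.exists_eq_succ_of_ne_zero (Nat.ne_zero_of_lt h)
    rw [Nat.succ_eq_add_one, gauss_succ_succ, ih (by omega), ih (by omega)]
    ring

theorem gauss_self (q : ℂ) (n : ℕ) : gauss q n n = 1 := by
  induction n with
  | zero => rfl
  | succ n ih => rw [gauss_succ_succ, ih, gauss_eq_zero_of_lt q n.lt_succ_self]; ring

theorem gauss_add_mul (q : ℂ) (k j : ℕ) :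
    gauss q (k + j) k * (qPoch q q k * qPoch q q j) = qPoch q q (k + j) := by
  suffices h : ∀ n k j, k + j = n →
      gauss q n k * (qPoch q q k * qPoch q q j) = qPoch q q n from h _ _ _ rfl
  intro n
  induction n with
  | zero =>
    intro k j h
    obtain ⟨rfl, rfl⟩ : k = 0 ∧ j = 0 := by omega
    simp [gauss_zero_right, qPoch_zero]
  | succ n ih =>
    intro k j h
    rcases k with _ | k
    · obtain rfl : j = n + 1 := by omega
      simp [gauss_zero_right, qPoch_zero]
    rcases j with _ | j
    · obtain rfl : k = n := by omega
      simp [gauss_self, qPoch_zero]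
    have h1 := ih (k + 1) j (by omega)
    have h2 := ih k (j + 1) (by omega)
    rw [gauss_succ_succ, qPoch_self_succ q n]
    have e : q ^ (n + 1) = q ^ (k + 1) * q ^ (j + 1) := by rw [← pow_add]; congr 1; omega
    rw [e]
    rw [qPoch_self_succ q k] at h1 ⊢
    rw [qPoch_self_succ q j] at h2 ⊢
    -- Uses 1 - q^{n+1} = q^{k+1}(1 - q^{j+1}) + (1 - q^{k+1}).
    linear_combination (q ^ (k + 1) * (1 - q ^ (j + 1))) * h1 + (1 - q ^ (k + 1)) * h2

theorem gauss_add {q : ℂ} (hq : ‖q‖ < 1) (k j : ℕ) :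
    gauss q (k + j) k = qPoch q q (k + j) / (qPoch q q k * qPoch q q j) := by
  rw [eq_div_iff (mul_ne_zero (qPoch_self_ne_zero hq _) (qPoch_self_ne_zero hq _)),
    gauss_add_mul]

/-- The finite `q`-binomial theorem. -/
theorem prod_one_sub_eq_sum_gauss {A : Type*} [CommRing A] [Algebra ℂ A] (q : ℂ) (n : ℕ) (y : A) :
    ∏ l ∈ Finset.range n, (1 - q ^ l • y) =
      ∑ k ∈ Finset.range (n + 1), (gauss q n k * (-1) ^ k * q ^ k.choose 2) • y ^ k := by
  induction n generalizing y with
  | zero => simp [gauss_zero_right]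
  | succ n ih =>
    rw [Finset.prod_range_succ']
    -- The product at qy is needed over two ranges; the extra term k = n + 1 has coefficient zero
    -- and aligns the sum with degree n + 1.
    have h1 : ∏ l ∈ Finset.range n, (1 - q ^ (l + 1) • y) =
        ∑ k ∈ Finset.range (n + 2), (gauss q n k * (-1) ^ k * q ^ (k + 1).choose 2) • y ^ k := by
      rw [Finset.sum_range_succ, gauss_eq_zero_of_lt q n.lt_succ_self]
      have := ih (q • y)
      simp only [smul_smul, ← pow_succ, smul_pow] at this
      rw [this]
      simp only [zero_mul, zero_smul, add_zero]
      refine Finset.sum_congr rfl fun k _ => ?_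
      congr 1
      rw [Nat.choose_succ_succ' k 1, Nat.choose_one_right, pow_add]
      ring
    have h2 : ∏ l ∈ Finset.range n, (1 - q ^ (l + 1) • y) =
        ∑ k ∈ Finset.range (n + 1), (gauss q n k * (-1) ^ k * q ^ (k + 1).choose 2) • y ^ k := by
      rw [h1, Finset.sum_range_succ, gauss_eq_zero_of_lt q n.lt_succ_self]
      simp
    rw [mul_sub, mul_one]
    nth_rewrite 1 [h1]
    rw [h2, Finset.sum_range_succ', Finset.sum_range_succ' _ (n + 1), Finset.sum_mul,
      add_sub_right_comm, ← Finset.sum_sub_distrib]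
    congr 1
    · refine Finset.sum_congr rfl fun k _ => ?_
      rw [gauss_succ_succ, pow_zero, one_smul, smul_mul_assoc, ← pow_succ, ← sub_smul]
      congr 1
      rw [Nat.choose_succ_succ' (k + 1) 1, Nat.choose_one_right]
      ring
    · simp [gauss_zero_right]

/-! ### Bailey pairs and the evaluation of Q_m -/

/-- A form of the `q`-Chu-Vandermonde sum. -/
theorem sum_gauss_mul_div (q : ℂ) (M : ℕ) (c : ℂ) (hc : ∀ i < M, c * q ^ (i + 1) ≠ 1) :
    ∑ l ∈ Finset.range (M + 1), gauss q M l * (c ^ l * q ^ l ^ 2 / qPoch q (c * q) l) =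
      1 / qPoch q (c * q) M := by
  induction M generalizing c with
  | zero => simp [gauss_zero_right, qPoch_zero]
  | succ M ih =>
    have hc' : ∀ i < M, c * q * q ^ (i + 1) ≠ 1 := fun i hi => by
      have := hc (i + 1) (by omega)
      rwa [mul_assoc, ← pow_succ']
    have h1 : 1 - c * q ≠ 0 := by
      have := hc 0 (by omega)
      rw [zero_add, pow_one] at this
      exact sub_ne_zero.2 this.symm
    -- Pascal's rule splits the sum. The l-th terms of the two pieces then combine, since (1 -
    -- cq^{l+1}) + cq^{l+1} = 1, into the summand for cq divided by 1 - cq.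
    have key : ∑ l ∈ Finset.range (M + 1 + 1),
        gauss q (M + 1) l * (c ^ l * q ^ l ^ 2 / qPoch q (c * q) l) =
        ∑ l ∈ Finset.range (M + 1 + 1),
          gauss q M l * q ^ l * (c ^ l * q ^ l ^ 2 / qPoch q (c * q) l) +
        ∑ l ∈ Finset.range (M + 1), gauss q M l *
          (c ^ (l + 1) * q ^ (l + 1) ^ 2 / qPoch q (c * q) (l + 1)) := by
      rw [Finset.sum_range_succ', Finset.sum_range_succ' _ (M + 1), add_right_comm,
        ← Finset.sum_add_distrib]
      congr 1
      · refine Finset.sum_congr rfl fun l _ => ?_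
        rw [gauss_succ_succ]
        ring
      · simp [gauss_zero_right]
    rw [key, Finset.sum_range_succ, gauss_eq_zero_of_lt q M.lt_succ_self, zero_mul, zero_mul,
      add_zero, ← Finset.sum_add_distrib, qPoch_succ_left, one_div, mul_inv, ← one_div (qPoch _ _ _),
      ← ih (c * q) hc', Finset.mul_sum]
    refine Finset.sum_congr rfl fun l hl => ?_
    have hl' : l ≤ M := by simpa [Nat.lt_succ_iff] using hl
    have hP : qPoch q (c * q * q) l ≠ 0 := qPoch_ne_zero fun i hi => by
      have := hc (i + 1) (by omega)
      rwa [mul_assoc (c * q), ← pow_succ', mul_assoc c, ← pow_succ']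
    have hlast : 1 - c * q ^ (l + 1) ≠ 0 := sub_ne_zero.2 (hc l (by omega)).symm
    have e2 : qPoch q (c * q) l = (1 - c * q) * qPoch q (c * q * q) l / (1 - c * q ^ (l + 1)) := by
      rw [eq_div_iff hlast, ← qPoch_succ_left, qPoch_succ]
      ring
    rw [qPoch_succ_left, e2]
    field_simp
    ring

/-- The coefficient of α_r in the Bailey lemma. With j = r + l it is the q-Chu-Vandermonde sum at c
= bq^{2r}, M = N - r. The denominators (bq^r;q)_{N+1}, in place of the customary (bq;q)_{N+r}, match
those of Q_m; the customary α_r is (b;q)_r/(1-b) times the present one. -/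
theorem bailey_kernel {q : ℂ} (hq : ‖q‖ < 1) {b : ℂ} {N r : ℕ} (hr : r ≤ N)
    (hb : ∀ i ≤ 2 * N, b * q ^ i ≠ 1) :
    b ^ r * q ^ r ^ 2 / (qPoch q q (N - r) * qPoch q (b * q ^ r) (N + 1)) =
      ∑ j ∈ Finset.Ico r (N + 1), b ^ j * q ^ j ^ 2 / qPoch q q (N - j) *
        (1 / (qPoch q q (j - r) * qPoch q (b * q ^ r) (j + 1))) := by
  obtain ⟨M, rfl⟩ := Nat.exists_eq_add_of_le hr
  have split : ∀ l, qPoch q (b * q ^ r) (r + l + 1) =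
      qPoch q (b * q ^ r) r * ((1 - b * q ^ (2 * r)) * qPoch q (b * q ^ (2 * r) * q) l) := by
    intro l
    rw [add_assoc, qPoch_add, ← qPoch_succ_left, mul_assoc b, ← pow_add, ← two_mul]
  have hc : ∀ i < M, b * q ^ (2 * r) * q ^ (i + 1) ≠ 1 := fun i hi => by
    rw [mul_assoc, ← pow_add]
    exact hb _ (by omega)
  have h1 : qPoch q (b * q ^ r) r ≠ 0 := qPoch_ne_zero fun i hi => by
    rw [mul_assoc, ← pow_add]
    exact hb _ (by omega)
  have h2 : 1 - b * q ^ (2 * r) ≠ 0 := sub_ne_zero.2 (hb _ (by omega)).symm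
  have V := sum_gauss_mul_div q M _ hc
  rw [Finset.sum_Ico_eq_sum_range, show r + M + 1 - r = M + 1 by omega, split,
    show r + M - r = M by omega]
  have hM := qPoch_self_ne_zero hq M
  have : b ^ r * q ^ r ^ 2 / (qPoch q q M * (qPoch q (b * q ^ r) r *
      ((1 - b * q ^ (2 * r)) * qPoch q (b * q ^ (2 * r) * q) M))) =
      b ^ r * q ^ r ^ 2 / (qPoch q q M * (qPoch q (b * q ^ r) r * (1 - b * q ^ (2 * r)))) *
        (1 / qPoch q (b * q ^ (2 * r) * q) M) := by
    rw [div_mul_div_comm, mul_one]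
    congr 1
    ring
  rw [this, ← V, Finset.mul_sum]
  refine Finset.sum_congr rfl fun l hl => ?_
  obtain ⟨p, rfl⟩ := Nat.exists_eq_add_of_le (show l ≤ M by simpa [Nat.lt_succ_iff] using hl)
  have h3 : qPoch q (b * q ^ (2 * r) * q) l ≠ 0 := qPoch_ne_zero fun i hi => by
    rw [mul_assoc, ← pow_succ']
    exact hc _ (by omega)
  rw [split, gauss_add hq, show r + (l + p) - (r + l) = p by omega, show r + l - r = l by omega]
  have h4 := qPoch_self_ne_zero hq l
  have h5 := qPoch_self_ne_zero hq p
  field_simp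
  ring

/-- The Bailey lemma, with all parameters sent to infinity. -/
theorem bailey_lemma {q : ℂ} (hq : ‖q‖ < 1) {b : ℂ} {N : ℕ}
    (hb : ∀ i ≤ 2 * N, b * q ^ i ≠ 1) (α : ℕ → ℂ) :
    ∑ r ∈ Finset.range (N + 1),
        α r * (b ^ r * q ^ r ^ 2) / (qPoch q q (N - r) * qPoch q (b * q ^ r) (N + 1)) =
      ∑ j ∈ Finset.range (N + 1), b ^ j * q ^ j ^ 2 / qPoch q q (N - j) *
        ∑ r ∈ Finset.range (j + 1),
          α r / (qPoch q q (j - r) * qPoch q (b * q ^ r) (j + 1)) := by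
  simp only [Finset.mul_sum, Finset.range_eq_Ico]
  rw [← Finset.sum_Ico_Ico_comm]
  refine Finset.sum_congr rfl fun r hr => ?_
  have hr' : r ≤ N := by simpa [Nat.lt_succ_iff] using hr
  rw [mul_div_assoc, bailey_kernel hq hr' hb, Finset.mul_sum]
  refine Finset.sum_congr rfl fun j _ => ?_
  ring

/-- The sequence `α` of the unit Bailey pair. -/
noncomputable def unitAlpha (q b : ℂ) (r : ℕ) : ℂ :=
  (-1) ^ r * q ^ r.choose 2 * (1 - b * q ^ (2 * r)) / qPoch q q r

/-- The sum telescopes. The closed form is used only for R ≤ j, where j - R is a true subtraction;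
the last term r = j is cancelled separately in `unit_bailey`. -/
theorem unit_bailey_partial {q : ℂ} (hq : ‖q‖ < 1) {b : ℂ} {j : ℕ} (hj : j ≠ 0)
    (hb : ∀ i ≤ 2 * j, b * q ^ i ≠ 1) {R : ℕ} (hR : R ≤ j) :
    ∑ r ∈ Finset.range R, unitAlpha q b r / (qPoch q q (j - r) * qPoch q (b * q ^ r) (j + 1)) =
      (1 - q ^ R) * (-1) ^ (R + 1) * q ^ R.choose 2 /
        (qPoch q q R * qPoch q q (j - R) * qPoch q (b * q ^ R) j * (1 - q ^ j)) := by
  induction R with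
  | zero => simp
  | succ R ih =>
    rw [Finset.sum_range_succ, ih (by omega), unitAlpha]
    obtain ⟨p, rfl⟩ := Nat.exists_eq_add_of_le hR
    rw [show R + 1 + p - R = p + 1 by omega, show R + 1 + p - (R + 1) = p by omega]
    have hsh : b * q ^ R * q = b * q ^ (R + 1) := by ring
    have e1 := qPoch_succ_left q (b * q ^ R) (R + 1 + p)
    rw [hsh] at e1
    have e2 := qPoch_succ q (b * q ^ R) (R + 1 + p)
    have n1 : 1 - b * q ^ R ≠ 0 := sub_ne_zero.2 (hb _ (by omega)).symm
    have n2 : 1 - b * q ^ R * q ^ (R + 1 + p) ≠ 0 := by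
      rw [mul_assoc, ← pow_add]
      exact sub_ne_zero.2 (hb _ (by omega)).symm
    have n3 : qPoch q (b * q ^ R) (R + 1 + p + 1) ≠ 0 := qPoch_ne_zero fun i hi => by
      rw [mul_assoc, ← pow_add]
      exact hb _ (by omega)
    have n4 := one_sub_pow_ne_zero hq hj
    have n5 := qPoch_self_ne_zero hq R
    have n6 := qPoch_self_ne_zero hq p
    have n7 := one_sub_pow_ne_zero hq R.succ_ne_zero
    have n8 := one_sub_pow_ne_zero hq p.succ_ne_zero
    have d1 : qPoch q (b * q ^ (R + 1)) (R + 1 + p) =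
        qPoch q (b * q ^ R) (R + 1 + p + 1) / (1 - b * q ^ R) := by
      rw [eq_div_iff n1, e1]; ring
    have d2 : qPoch q (b * q ^ R) (R + 1 + p) =
        qPoch q (b * q ^ R) (R + 1 + p + 1) / (1 - b * q ^ R * q ^ (R + 1 + p)) := by
      rw [eq_div_iff n2, e2]
    rw [d1, d2, qPoch_self_succ q R, qPoch_self_succ q p, Nat.choose_succ_succ' R 1,
      Nat.choose_one_right]
    generalize qPoch q (b * q ^ R) (R + 1 + p + 1) = W at *
    simp only [Nat.succ_eq_add_one] at *
    field_simp
    ring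

theorem unit_bailey {q : ℂ} (hq : ‖q‖ < 1) {b : ℂ} {j : ℕ} (hj : j ≠ 0)
    (hb : ∀ i ≤ 2 * j, b * q ^ i ≠ 1) :
    ∑ r ∈ Finset.range (j + 1),
      unitAlpha q b r / (qPoch q q (j - r) * qPoch q (b * q ^ r) (j + 1)) = 0 := by
  rw [Finset.sum_range_succ, unit_bailey_partial hq hj hb le_rfl, unitAlpha, qPoch_succ,
    Nat.sub_self, qPoch_zero]
  have n1 := one_sub_pow_ne_zero hq hj
  have n2 := qPoch_self_ne_zero hq j
  have n3 : 1 - b * q ^ (2 * j) ≠ 0 := sub_ne_zero.2 (hb _ le_rfl).symm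
  have n4 : qPoch q (b * q ^ j) j ≠ 0 := qPoch_ne_zero fun i hi => by
    rw [mul_assoc, ← pow_add]
    exact hb _ (by omega)
  have e : b * q ^ j * q ^ j = b * q ^ (2 * j) := by ring
  rw [e]
  field_simp
  ring

/-- The polynomial `∑_j [N, j] q^{j²} b^j`. -/
noncomputable def stieltjesWigert (q : ℂ) (N : ℕ) (b : ℂ) : ℂ :=
  ∑ j ∈ Finset.range (N + 1), gauss q N j * q ^ j ^ 2 * b ^ j

/-- First iteration of the Bailey lemma: by `unit_bailey` only j = 0 survives on the right. -/
theorem sum_unitAlpha {q : ℂ} (hq : ‖q‖ < 1) {b : ℂ} {N : ℕ}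
    (hb : ∀ i ≤ 2 * N, b * q ^ i ≠ 1) :
    ∑ r ∈ Finset.range (N + 1), unitAlpha q b r * (b ^ r * q ^ r ^ 2) /
      (qPoch q q (N - r) * qPoch q (b * q ^ r) (N + 1)) = 1 / qPoch q q N := by
  rw [bailey_lemma hq hb, Finset.sum_range_succ', Finset.sum_eq_zero]
  · have : 1 - b ≠ 0 := sub_ne_zero.2 (by simpa [eq_comm] using hb 0 (by omega))
    simp [unitAlpha, qPoch_zero, qPoch_succ, this]
  · intro j hj
    rw [unit_bailey hq j.succ_ne_zero, mul_zero]
    intro i hi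
    exact hb i (by have := Finset.mem_range.1 hj; omega)

/-- Second iteration: the inner sums are now 1/(q;q)_j, which completes the Gaussian binomials. -/
theorem sum_unitAlpha_sq {q : ℂ} (hq : ‖q‖ < 1) {b : ℂ} {N : ℕ}
    (hb : ∀ i ≤ 2 * N, b * q ^ i ≠ 1) :
    qPoch q q N * ∑ r ∈ Finset.range (N + 1),
      unitAlpha q b r * (b ^ r * q ^ r ^ 2) * (b ^ r * q ^ r ^ 2) /
      (qPoch q q (N - r) * qPoch q (b * q ^ r) (N + 1)) = stieltjesWigert q N b := by
  rw [bailey_lemma hq hb, stieltjesWigert, Finset.mul_sum]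
  refine Finset.sum_congr rfl fun j hj => ?_
  have hj' : j ≤ N := by simpa [Nat.lt_succ_iff] using hj
  rw [sum_unitAlpha hq fun i hi => hb i (by omega)]
  obtain ⟨p, rfl⟩ := Nat.exists_eq_add_of_le hj'
  rw [gauss_add hq, Nat.add_sub_cancel_left]
  ring

/-- Reversal of (q^{-N};q)_i with N = i + p, free of division; it turns the coefficients of Q_m into
those of `unitAlpha`. -/
theorem qPoch_neg_pow {q : ℂ} (hq0 : q ≠ 0) (p i : ℕ) :
    qPoch q (q ^ (-((i + p : ℕ) : ℤ))) i * qPoch q q p * q ^ ((i + p) * i) =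
      (-1) ^ i * q ^ i.choose 2 * qPoch q q (i + p) := by
  induction i generalizing p with
  | zero => simp [qPoch_zero]
  | succ i ih =>
    have h := ih (p + 1)
    rw [show i + (p + 1) = i + 1 + p by ring] at h
    have e : q ^ (-((i + 1 + p : ℕ) : ℤ)) * q ^ i * q ^ (p + 1) = 1 := by
      rw [mul_assoc, ← pow_add, ← zpow_natCast, ← zpow_add₀ hq0]
      convert zpow_zero q using 2
      push_cast
      ring
    rw [qPoch_succ, Nat.choose_succ_succ' i 1, Nat.choose_one_right, pow_add]
    rw [qPoch_self_succ] at h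
    have e' : q ^ ((i + 1 + p) * (i + 1)) = q ^ ((i + 1 + p) * i) * q ^ i * q ^ (p + 1) := by
      rw [← pow_add, ← pow_add]
      congr 1
      ring
    rw [e']
    linear_combination (-q ^ i) * h - qPoch q (q ^ (-((i + 1 + p : ℕ) : ℤ))) i * qPoch q q p *
      q ^ ((i + 1 + p) * i) * q ^ i * e

theorem Q_eq_stieltjesWigert {q : ℂ} (hq0 : q ≠ 0) (hq : ‖q‖ < 1) {N : ℕ} {b : ℂ}
    (hb : QRegular q (N + 2) b) : Q q (N + 2) b = stieltjesWigert q N b := by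
  have hb' : ∀ i ≤ 2 * N, b * q ^ i ≠ 1 := fun i hi => hb i (by omega)
  rw [← sum_unitAlpha_sq hq hb', Q, show N + 2 - 1 = N + 1 from rfl, Finset.mul_sum]
  refine Finset.sum_congr rfl fun i hi => ?_
  obtain ⟨p, rfl⟩ := Nat.exists_eq_add_of_le (show i ≤ N by simpa [Nat.lt_succ_iff] using hi)
  have h := qPoch_neg_pow hq0 p i
  have e1 : (2 : ℤ) - ((i + p + 2 : ℕ) : ℤ) = -((i + p : ℕ) : ℤ) := by push_cast; ring
  have e2 : q ^ ((2 * (i : ℤ) - 2 + ((i + p + 2 : ℕ) : ℤ)) * i) =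
      q ^ ((i + p) * i) * q ^ (2 * i ^ 2) := by
    rw [← pow_add, ← zpow_natCast]
    congr 1
    push_cast
    ring
  rw [e1, e2, unitAlpha, Nat.add_sub_cancel_left]
  have n1 := qPoch_self_ne_zero hq i
  have n2 := qPoch_self_ne_zero hq p
  have n3 : qPoch q (b * q ^ i) (i + p + 1) ≠ 0 := qPoch_ne_zero fun l hl => by
    rw [mul_assoc, ← pow_add]
    exact hb' _ (by omega)
  generalize qPoch q (q ^ (-((i + p : ℕ) : ℤ))) i = Z at *
  field_simp
  linear_combination ((1 - b * q ^ (2 * i)) * b ^ (2 * i) * q ^ (2 * i ^ 2)) * h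

/-! ### The q-shift operator and its factorials -/

/-- The operator `φ ↦ (a ↦ -a φ(aq))`. -/
noncomputable def shiftOp (q : ℂ) : Module.End ℂ (ℂ → ℂ) where
  toFun φ a := -a * φ (a * q)
  map_add' φ ψ := by ext a; simp [mul_add]
  map_smul' c φ := by ext a; simp; ring

theorem shiftOp_pow_apply (q : ℂ) (k : ℕ) (φ : ℂ → ℂ) (a : ℂ) :
    (shiftOp q ^ k) φ a = (-a) ^ k * q ^ k.choose 2 * φ (a * q ^ k) := by
  induction k generalizing φ a with
  | zero => simp
  | succ k ih =>
    rw [pow_succ, Module.End.mul_apply, ih, Nat.choose_succ_succ' k 1, Nat.choose_one_right]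
    simp only [shiftOp, LinearMap.coe_mk, AddHom.coe_mk]
    rw [mul_assoc a, ← pow_succ]
    ring

/-- The `q`-shifted factorial `(cS;q)_n` of a multiple of the operator `S = shiftOp q`. -/
noncomputable def opPoch (q c : ℂ) (n : ℕ) : Module.End ℂ (ℂ → ℂ) :=
  Polynomial.aeval (shiftOp q)
    (∏ l ∈ Finset.range n, (1 - Polynomial.C (c * q ^ l) * Polynomial.X))

theorem polynomial_prod_eq_sum_gauss (q c : ℂ) (n : ℕ) :
    ∏ l ∈ Finset.range n, (1 - Polynomial.C (c * q ^ l) * Polynomial.X) =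
      ∑ k ∈ Finset.range (n + 1),
        Polynomial.C (gauss q n k * (-1) ^ k * q ^ k.choose 2 * c ^ k) * Polynomial.X ^ k := by
  have h := prod_one_sub_eq_sum_gauss q n (Polynomial.C c * Polynomial.X)
  simp only [Algebra.smul_def, Polynomial.algebraMap_eq] at h
  convert h using 2 with l _ k _
  · rw [← mul_assoc, ← map_mul, mul_comm c]
  · rw [mul_pow, ← mul_assoc, ← map_pow, ← map_mul]

theorem aeval_shiftOp_C_mul_X_pow (q g : ℂ) (k : ℕ) (φ : ℂ → ℂ) (a : ℂ) :
    Polynomial.aeval (shiftOp q) (Polynomial.C g * Polynomial.X ^ k) φ a =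
      g * ((-a) ^ k * q ^ k.choose 2 * φ (a * q ^ k)) := by
  rw [map_mul, Polynomial.aeval_C, map_pow, Polynomial.aeval_X, Module.End.mul_apply,
    Module.algebraMap_end_apply, Pi.smul_apply, shiftOp_pow_apply, smul_eq_mul]

theorem opPoch_apply (q c : ℂ) (n : ℕ) (φ : ℂ → ℂ) (a : ℂ) :
    opPoch q c n φ a = ∑ k ∈ Finset.range (n + 1),
      gauss q n k * (c * a) ^ k * q ^ (2 * k.choose 2) * φ (a * q ^ k) := by
  rw [opPoch, polynomial_prod_eq_sum_gauss, map_sum, LinearMap.sum_apply, Finset.sum_apply]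
  refine Finset.sum_congr rfl fun k _ => ?_
  rw [aeval_shiftOp_C_mul_X_pow]
  have : ((-1 : ℂ) ^ k) * (-1) ^ k = 1 := by rw [← mul_pow]; simp
  rw [neg_pow a, mul_pow, two_mul, pow_add]
  linear_combination
    (gauss q n k * c ^ k * a ^ k * q ^ k.choose 2 * q ^ k.choose 2 * φ (a * q ^ k)) * this

theorem opPoch_add (q c : ℂ) (m n : ℕ) :
    opPoch q c (m + n) = opPoch q c m * opPoch q (c * q ^ m) n := by
  have h : ∀ l, c * q ^ m * q ^ l = c * q ^ (m + l) := fun l => by ring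
  simp only [opPoch, ← map_mul, Finset.prod_range_add, h]

/-- Both sides are polynomials in the single operator S, so commutativity is inherited from the
polynomial ring. -/
theorem opPoch_commute (q c d : ℂ) (m n : ℕ) :
    opPoch q c m * opPoch q d n = opPoch q d n * opPoch q c m := by
  rw [opPoch, opPoch, ← map_mul, mul_comm, map_mul]

theorem opPoch_zero (q c : ℂ) : opPoch q c 0 = 1 := by simp [opPoch]

theorem opPoch_one_apply (q c : ℂ) (φ : ℂ → ℂ) (a : ℂ) :
    opPoch q c 1 φ a = φ a + c * a * φ (a * q) := by
  rw [opPoch_apply, Finset.sum_range_succ, Finset.sum_range_one]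
  simp [gauss_zero_right, gauss_self]

/-! ### Infinite products: Euler's expansion and uniform bounds -/

theorem qPochInf_ne_zero {q : ℂ} (hq : ‖q‖ < 1) {x : ℂ} (hx : ∀ i : ℕ, x * q ^ i ≠ 1) :
    qPochInf q x ≠ 0 := by
  have hs : Summable fun i : ℕ => ‖-(x * q ^ i)‖ := by
    simp only [norm_neg, norm_mul, norm_pow]
    exact (summable_geometric_of_lt_one (norm_nonneg q) hq).mul_left _
  have := tprod_one_add_ne_zero_of_summable (f := fun i : ℕ => -(x * q ^ i)) (fun i => by
    rw [← sub_eq_add_neg]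
    exact sub_ne_zero.2 (hx i).symm) hs
  simpa [qPochInf, sub_eq_add_neg] using this

theorem qPochInf_self_ne_zero {q : ℂ} (hq : ‖q‖ < 1) : qPochInf q q ≠ 0 :=
  qPochInf_ne_zero hq fun i => by
    rw [← pow_succ']
    exact (sub_ne_zero.1 (one_sub_pow_ne_zero hq i.succ_ne_zero)).symm

theorem exists_inv_qPoch_self_le {q : ℂ} (hq : ‖q‖ < 1) :
    ∃ C : ℝ, 0 ≤ C ∧ ∀ n, ‖(qPoch q q n)⁻¹‖ ≤ C := by
  have ht : Filter.Tendsto (fun n => (qPoch q q n)⁻¹) Filter.atTop (𝓝 (qPochInf q q)⁻¹) :=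
    ((multipliable_qPochInf hq q).tendsto_prod_tprod_nat).inv₀ (qPochInf_self_ne_zero hq)
  obtain ⟨C, hC⟩ := (Metric.isBounded_range_of_tendsto _ ht).exists_norm_le
  exact ⟨C, (norm_nonneg _).trans (hC _ ⟨0, rfl⟩), fun n => hC _ ⟨n, rfl⟩⟩

theorem tendsto_mul_pow_zero {q : ℂ} (hq : ‖q‖ < 1) (x : ℂ) :
    Filter.Tendsto (fun n : ℕ => x * q ^ n) Filter.atTop (𝓝 0) := by
  simpa using (tendsto_pow_atTop_nhds_zero_of_norm_lt_one hq).const_mul x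

theorem summable_pow_mul_pow_choose {ρ : ℝ} (h0 : 0 ≤ ρ) (h1 : ρ < 1) (r : ℝ) :
    Summable fun n : ℕ => r ^ n * ρ ^ n.choose 2 := by
  refine summable_of_ratio_norm_eventually_le (r := 1 / 2) (by norm_num) ?_
  have ht : Filter.Tendsto (fun n : ℕ => ‖r * ρ ^ n‖) Filter.atTop (𝓝 0) := by
    simpa using ((tendsto_pow_atTop_nhds_zero_of_lt_one h0 h1).const_mul r).norm
  filter_upwards [ht.eventually_le_const (show (0 : ℝ) < 1 / 2 by norm_num)] with n hn
  rw [show r ^ (n + 1) * ρ ^ (n + 1).choose 2 = r * ρ ^ n * (r ^ n * ρ ^ n.choose 2) by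
    rw [Nat.choose_succ_succ' n 1, Nat.choose_one_right]; ring, norm_mul]
  exact mul_le_mul_of_nonneg_right hn (norm_nonneg _)

/-- The `j`-th term of Euler's expansion of `(x;q)_∞`. -/
noncomputable def eulerTerm (q x : ℂ) (j : ℕ) : ℂ :=
  (-x) ^ j * q ^ j.choose 2 / qPoch q q j

theorem norm_eulerTerm_le {q x : ℂ} {C r : ℝ} (hC : ∀ n, ‖(qPoch q q n)⁻¹‖ ≤ C)
    (hx : ‖x‖ ≤ r) (j : ℕ) : ‖eulerTerm q x j‖ ≤ r ^ j * ‖q‖ ^ j.choose 2 * C := by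
  rw [eulerTerm, div_eq_mul_inv, norm_mul, norm_mul, norm_pow, norm_pow, norm_neg]
  have hr := (norm_nonneg x).trans hx
  have := hC j
  gcongr

theorem summable_eulerTerm {q : ℂ} (hq : ‖q‖ < 1) (x : ℂ) : Summable (eulerTerm q x) := by
  obtain ⟨C, -, hC⟩ := exists_inv_qPoch_self_le hq
  exact .of_norm_bounded ((summable_pow_mul_pow_choose (norm_nonneg q) hq ‖x‖).mul_right C)
    (norm_eulerTerm_le hC le_rfl)

theorem continuous_of_forall_ball {E F : Type*} [NormedAddCommGroup E] [TopologicalSpace F]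
    {f : E → F} (h : ∀ r : ℝ, ContinuousOn f (Metric.ball 0 r)) : Continuous f :=
  continuous_iff_continuousAt.2 fun x => (h (‖x‖ + 1)).continuousAt
    (Metric.isOpen_ball.mem_nhds (by simp))

theorem continuous_tsum_eulerTerm {q : ℂ} (hq : ‖q‖ < 1) :
    Continuous fun x => ∑' j, eulerTerm q x j := by
  obtain ⟨C, -, hC⟩ := exists_inv_qPoch_self_le hq
  refine continuous_of_forall_ball fun r => continuousOn_tsum (fun j => ?_)
    ((summable_pow_mul_pow_choose (norm_nonneg q) hq r).mul_right C)
    fun j x hx => norm_eulerTerm_le hC (mem_ball_zero_iff.1 hx).le j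
  unfold eulerTerm
  fun_prop

/-- Euler's expansion `(x;q)_∞ = ∑_j (-x)^j q^{j(j-1)/2} / (q;q)_j`. -/
theorem hasSum_eulerTerm {q : ℂ} (hq : ‖q‖ < 1) (x : ℂ) :
    HasSum (eulerTerm q x) (qPochInf q x) := by
  set f : ℂ → ℂ := fun x => ∑' j, eulerTerm q x j with hf
  have step : ∀ x, f x = (1 - x) * f (x * q) := by
    intro x
    have h1 := (summable_eulerTerm hq x).hasSum
    have h2 := (summable_eulerTerm hq (x * q)).hasSum
    have h3 : HasSum (fun j => eulerTerm q x j - eulerTerm q (x * q) j) (-x * f (x * q)) := by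
      rw [← hasSum_nat_add_iff' 1]
      simp only [Finset.sum_range_one]
      have e0 : eulerTerm q x 0 - eulerTerm q (x * q) 0 = 0 := by simp [eulerTerm]
      rw [e0, sub_zero]
      refine HasSum.congr_fun (h2.mul_left (-x)) fun j => ?_
      have n1 := one_sub_pow_ne_zero hq j.succ_ne_zero
      have n2 := qPoch_self_ne_zero hq j
      rw [eulerTerm, eulerTerm, eulerTerm, qPoch_self_succ, Nat.choose_succ_succ' j 1,
        Nat.choose_one_right]
      simp only [Nat.succ_eq_add_one] at n1
      field_simp
      ring
    have := h3.unique (h1.sub h2)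
    linear_combination -this
  -- Iterating the functional equation and letting n → ∞ identifies f with the product, by
  -- continuity of f at 0 and f(0) = 1.
  have iter : ∀ n, f x = qPoch q x n * f (x * q ^ n) := by
    intro n
    induction n with
    | zero => simp [qPoch_zero]
    | succ n ih =>
      rw [ih, step, qPoch_succ, pow_succ]
      ring_nf
  have hf0 : f 0 = 1 := by
    rw [hf]
    simp only
    rw [tsum_eq_single 0]
    · simp [eulerTerm, qPoch_zero]
    · intro j hj
      simp [eulerTerm, hj]
  have lim : Filter.Tendsto (fun n => qPoch q x n * f (x * q ^ n)) Filter.atTop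
      (𝓝 (qPochInf q x * f 0)) :=
    (multipliable_qPochInf hq x).tendsto_prod_tprod_nat.mul
      (((continuous_tsum_eulerTerm hq).tendsto 0).comp (tendsto_mul_pow_zero hq x))
  have heq : f x = qPochInf q x := by
    rw [hf0, mul_one] at lim
    refine tendsto_nhds_unique ?_ lim
    simp only [← iter]
    exact tendsto_const_nhds
  rw [← heq]
  exact (summable_eulerTerm hq x).hasSum

theorem continuous_qPochInf {q : ℂ} (hq : ‖q‖ < 1) : Continuous (qPochInf q) := by
  have : qPochInf q = fun x => ∑' j, eulerTerm q x j :=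
    funext fun x => (hasSum_eulerTerm hq x).tsum_eq.symm
  rw [this]
  exact continuous_tsum_eulerTerm hq

theorem exists_qPochInf_le {q : ℂ} (hq : ‖q‖ < 1) (r : ℝ) :
    ∃ B : ℝ, 0 ≤ B ∧ ∀ x : ℂ, ‖x‖ ≤ r → ∀ n : ℕ, ‖qPochInf q (x * q ^ n)‖ ≤ B := by
  obtain ⟨B, hB⟩ := (isCompact_closedBall (0 : ℂ) r).exists_bound_of_continuousOn
    (continuous_qPochInf hq).continuousOn
  refine ⟨max B 0, le_max_right _ _, fun x hx n => (hB _ ?_).trans (le_max_left _ _)⟩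
  rw [mem_closedBall_zero_iff, norm_mul, norm_pow]
  exact (mul_le_of_le_one_right (norm_nonneg _) (pow_le_one₀ (norm_nonneg _) hq.le)).trans hx

theorem exists_qPoch_le {q : ℂ} (hq : ‖q‖ < 1) (r : ℝ) :
    ∃ B : ℝ, ∀ x : ℂ, ‖x‖ ≤ r → ∀ n k : ℕ, ‖qPoch q (x * q ^ n) k‖ ≤ B := by
  refine ⟨Real.exp (∑' l : ℕ, r * ‖q‖ ^ l), fun x hx n k => ?_⟩
  have hr : 0 ≤ r := (norm_nonneg x).trans hx
  have hs : Summable fun l : ℕ => r * ‖q‖ ^ l :=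
    (summable_geometric_of_lt_one (norm_nonneg q) hq).mul_left _
  have h1 : ‖qPoch q (x * q ^ n) k‖ ≤ ∏ l ∈ Finset.range k, Real.exp (r * ‖q‖ ^ l) := by
    rw [qPoch, norm_prod]
    refine Finset.prod_le_prod (fun _ _ => norm_nonneg _) fun l _ => ?_
    refine (norm_sub_le _ _).trans ?_
    rw [norm_one, add_comm]
    refine le_trans ?_ (Real.add_one_le_exp _)
    rw [norm_mul, norm_mul, norm_pow, norm_pow]
    have : ‖x‖ * ‖q‖ ^ n ≤ r :=
      (mul_le_of_le_one_right (norm_nonneg _) (pow_le_one₀ (norm_nonneg _) hq.le)).trans hx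
    gcongr
  rw [← Real.exp_sum] at h1
  exact h1.trans (Real.exp_le_exp.2 (hs.sum_le_tsum _ fun l _ => by positivity))

theorem qPochInf_eq_mul {q : ℂ} (hq : ‖q‖ < 1) (x : ℂ) (s : ℕ) :
    qPochInf q (x * q ^ s) = (1 - x * q ^ s) * qPochInf q (x * q ^ (s + 1)) := by
  have := qPoch_mul_qPochInf hq (x * q ^ s) 1
  rw [← this, pow_one, pow_succ, mul_assoc x]
  simp [qPoch]

/-! ### The functions K_r inverting (S;q)_{r+1} on the constant 1 -/

/-- The terms of the series `kernelSum`. -/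
noncomputable def kernelTerm (q : ℂ) (r : ℕ) (x : ℂ) (s : ℕ) : ℂ :=
  q ^ ((r + 1) * s) / qPoch q q s * qPochInf q (x * q ^ s)

/-- `(q;q)_∞ / (q;q)_r ∑_s q^{(r+1)s} (xq^s;q)_∞ / (q;q)_s`. -/
noncomputable def kernelSum (q : ℂ) (r : ℕ) (x : ℂ) : ℂ :=
  qPochInf q q / qPoch q q r * ∑' s, kernelTerm q r x s

theorem summable_kernelTerm {q : ℂ} (hq : ‖q‖ < 1) (r : ℕ) (x : ℂ) :
    Summable (kernelTerm q r x) := by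
  obtain ⟨C, hC0, hC⟩ := exists_inv_qPoch_self_le hq
  obtain ⟨B, hB0, hB⟩ := exists_qPochInf_le hq ‖x‖
  refine .of_norm_bounded
    (((summable_geometric_of_lt_one (norm_nonneg q) hq).mul_right C).mul_right B) fun s => ?_
  rw [kernelTerm, div_eq_mul_inv, norm_mul, norm_mul, norm_pow]
  have h1 := hC s
  have h2 := hB x le_rfl s
  have h3 : ‖q‖ ^ ((r + 1) * s) ≤ ‖q‖ ^ s :=
    pow_le_pow_of_le_one (norm_nonneg q) hq.le (Nat.le_mul_of_pos_left s r.succ_pos)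
  gcongr

/-- Holds term by term after the shift s ↦ s + 1, where 1 - q^{s+1} cancels the last factor of
(q;q)_{s+1}. -/
theorem kernelSum_succ {q : ℂ} (hq : ‖q‖ < 1) (r : ℕ) :
    opPoch q (q ^ (r + 1)) 1 (kernelSum q (r + 1)) = kernelSum q r := by
  ext x
  rw [opPoch_one_apply]
  have h1 := (summable_kernelTerm hq r x).hasSum
  have h2 := (summable_kernelTerm hq (r + 1) x).hasSum
  have h3 := (summable_kernelTerm hq (r + 1) (x * q)).hasSum
  have h4 := (hasSum_nat_add_iff' 1).2 (h1.sub h2)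
  have h0 : kernelTerm q r x 0 - kernelTerm q (r + 1) x 0 = 0 := by simp [kernelTerm]
  rw [Finset.sum_range_one, h0, sub_zero] at h4
  have h5 := (h3.mul_left (q ^ (r + 1) * x)).add (h1.mul_left (q ^ (r + 1)))
  have h6 := h5.unique (h4.congr_fun fun s => by
    have n1 : 1 - q ^ (s + 1) ≠ 0 := one_sub_pow_ne_zero hq (Nat.succ_ne_zero s)
    have n2 := qPoch_self_ne_zero hq s
    have e : x * q * q ^ s = x * q ^ (s + 1) := by ring
    rw [kernelTerm, kernelTerm, kernelTerm, kernelTerm, e, qPochInf_eq_mul hq x s,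
      qPoch_self_succ]
    field_simp
    ring)
  have n3 : 1 - q ^ (r + 1) ≠ 0 := one_sub_pow_ne_zero hq (Nat.succ_ne_zero r)
  have n4 := qPoch_self_ne_zero hq r
  rw [kernelSum, kernelSum, kernelSum, qPoch_self_succ]
  field_simp
  linear_combination (qPochInf q q) * h6

theorem tendsto_inv_qPoch_mul {q : ℂ} (hq : ‖q‖ < 1) (x : ℂ) :
    Filter.Tendsto (fun s => (qPoch q q s)⁻¹ * qPochInf q (x * q ^ s)) Filter.atTop
      (𝓝 (qPochInf q q)⁻¹) := by
  have h1 : Filter.Tendsto (fun s => (qPoch q q s)⁻¹) Filter.atTop (𝓝 (qPochInf q q)⁻¹) :=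
    ((multipliable_qPochInf hq q).tendsto_prod_tprod_nat).inv₀ (qPochInf_self_ne_zero hq)
  have h2 := ((continuous_qPochInf hq).tendsto 0).comp (tendsto_mul_pow_zero hq x)
  have h3 : qPochInf q 0 = 1 := by simp [qPochInf]
  rw [h3] at h2
  simpa using h1.mul h2

theorem kernelSum_zero {q : ℂ} (hq : ‖q‖ < 1) : opPoch q 1 1 (kernelSum q 0) = 1 := by
  ext x
  rw [opPoch_one_apply]
  have h1 := (summable_kernelTerm hq 0 x).hasSum
  have h2 := (summable_kernelTerm hq 0 (x * q)).hasSum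
  -- The series telescopes along z, with z_0 = 0 and limit 1/(q;q)_∞.
  set z : ℕ → ℂ := fun s => (1 - q ^ s) * ((qPoch q q s)⁻¹ * qPochInf q (x * q ^ s)) with hz
  have h3 : HasSum (fun s => z (s + 1) - z s)
      (∑' s, kernelTerm q 0 x s + x * ∑' s, kernelTerm q 0 (x * q) s) := by
    refine (h1.add (h2.mul_left x)).congr_fun fun s => ?_
    have n1 : 1 - q ^ (s + 1) ≠ 0 := one_sub_pow_ne_zero hq (Nat.succ_ne_zero s)
    have n2 := qPoch_self_ne_zero hq s
    have e : x * q * q ^ s = x * q ^ (s + 1) := by ring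
    simp only [hz]
    rw [kernelTerm, kernelTerm, e, qPochInf_eq_mul hq x s, qPoch_self_succ]
    field_simp
    ring
  have h4 := h3.tendsto_sum_nat
  simp only [Finset.sum_range_sub] at h4
  have h5 : Filter.Tendsto (fun n => z n - z 0) Filter.atTop (𝓝 (qPochInf q q)⁻¹) := by
    have := ((tendsto_pow_atTop_nhds_zero_of_norm_lt_one hq).const_sub 1).mul
      (tendsto_inv_qPoch_mul hq x)
    simpa [hz] using this
  have h6 := tendsto_nhds_unique h4 h5
  have n := qPochInf_self_ne_zero hq
  rw [kernelSum, kernelSum, qPoch_zero, div_one, one_mul, Pi.one_apply]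
  calc _ = qPochInf q q *
        (∑' s, kernelTerm q 0 x s + x * ∑' s, kernelTerm q 0 (x * q) s) := by ring
    _ = 1 := by rw [h6, mul_inv_cancel₀ n]

theorem opPoch_kernelSum {q : ℂ} (hq : ‖q‖ < 1) (r : ℕ) :
    opPoch q 1 (r + 1) (kernelSum q r) = 1 := by
  induction r with
  | zero => exact kernelSum_zero hq
  | succ r ih => rw [opPoch_add, Module.End.mul_apply, one_mul, kernelSum_succ hq, ih]

theorem opPoch_self_kernelSum {q : ℂ} (hq : ‖q‖ < 1) (r : ℕ) :
    opPoch q q r (kernelSum q r) = kernelSum q 0 := by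
  induction r with
  | zero => rw [opPoch_zero, Module.End.one_apply]
  | succ r ih => rw [opPoch_add, Module.End.mul_apply, ← pow_succ', kernelSum_succ hq, ih]

/-! ### Expansion in powers of b -/

/-- The terms of the series defining the entire extension of `P`, with `c` in place of
`1 / q ^ m`. -/
noncomputable def extTerm (q c a b : ℂ) (n : ℕ) : ℂ :=
  q ^ n * qPochInf q (q * q ^ n) * qPochInf q (a * q ^ n) * qPochInf q (b * q ^ n) *
    qPoch q (a * b * c * q ^ n) n

theorem choose_two_add (k j : ℕ) : (k + j).choose 2 = k.choose 2 + j.choose 2 + k * j := by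
  induction k with
  | zero => simp
  | succ k ih =>
    rw [show k + 1 + j = k + j + 1 by ring, Nat.choose_succ_succ' (k + j) 1,
      Nat.choose_succ_succ' k 1, Nat.choose_one_right, Nat.choose_one_right, ih]
    ring

theorem sq_eq_add_two_mul_choose (k : ℕ) : k ^ 2 = k + 2 * k.choose 2 := by
  induction k with
  | zero => simp
  | succ k ih =>
    rw [Nat.choose_succ_succ' k 1, Nat.choose_one_right]
    linarith

/-- The terms of the triple series that `∑ extTerm` expands into, indexed by `((k, s), j)`. -/
noncomputable def tripleTerm (q c a b : ℂ) (p : (ℕ × ℕ) × ℕ) : ℂ :=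
  qPochInf q q * q ^ (p.1.1 + p.1.2) / (qPoch q q p.1.1 * qPoch q q p.1.2) *
    (-(a * b * c)) ^ p.1.1 * q ^ (p.1.1.choose 2 + (p.1.1 + p.1.2) * p.1.1) *
    qPochInf q (a * q ^ (p.1.1 + p.1.2)) * eulerTerm q (b * q ^ (p.1.1 + p.1.2)) p.2

theorem summable_tripleTerm {q : ℂ} (hq : ‖q‖ < 1) (c a b : ℂ) :
    Summable (tripleTerm q c a b) := by
  obtain ⟨C, hC0, hC⟩ := exists_inv_qPoch_self_le hq
  obtain ⟨B, hB0, hB⟩ := exists_qPochInf_le hq ‖a‖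
  have s1 := summable_pow_mul_pow_choose (norm_nonneg q) hq ‖a * b * c‖
  have s2 := summable_geometric_of_lt_one (norm_nonneg q) hq
  have s3 := (summable_pow_mul_pow_choose (norm_nonneg q) hq ‖b‖).mul_right C
  have s := (((s1.mul_of_nonneg s2 (fun _ => by positivity) fun _ => by positivity).mul_of_nonneg
    s3 (fun _ => by positivity) fun _ => by positivity).mul_left (‖qPochInf q q‖ * C * C * B))
  refine .of_norm_bounded s fun p => ?_
  obtain ⟨⟨k, s⟩, j⟩ := p
  simp only [tripleTerm]
  have h1 := hC k
  have h2 := hC s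
  have h3 := hB a le_rfl (k + s)
  have h4 : ‖q‖ ^ (k + s) ≤ ‖q‖ ^ s :=
    pow_le_pow_of_le_one (norm_nonneg q) hq.le (by omega)
  have h5 : ‖q‖ ^ (k.choose 2 + (k + s) * k) ≤ ‖q‖ ^ k.choose 2 :=
    pow_le_pow_of_le_one (norm_nonneg q) hq.le (by omega)
  have h6 : ‖eulerTerm q (b * q ^ (k + s)) j‖ ≤ ‖b‖ ^ j * ‖q‖ ^ j.choose 2 * C := by
    refine norm_eulerTerm_le hC ?_ j
    rw [norm_mul, norm_pow]
    exact mul_le_of_le_one_right (norm_nonneg _) (pow_le_one₀ (norm_nonneg _) hq.le)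
  rw [div_eq_mul_inv, mul_inv, norm_mul, norm_mul, norm_mul, norm_mul, norm_mul, norm_mul,
    norm_mul, norm_pow, norm_pow, norm_pow, norm_neg]
  calc _ ≤ ‖qPochInf q q‖ * ‖q‖ ^ s * (C * C) * ‖a * b * c‖ ^ k * ‖q‖ ^ k.choose 2 * B *
        (‖b‖ ^ j * ‖q‖ ^ j.choose 2 * C) := by gcongr
    _ = _ := by ring

theorem hasSum_sum_antidiagonal {F : (ℕ × ℕ) × ℕ → ℂ} (hF : Summable F) {g : ℕ × ℕ → ℂ}
    (hg : ∀ p, HasSum (fun i => F (p, i)) (g p)) :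
    HasSum (fun n => ∑ p ∈ Finset.HasAntidiagonal.antidiagonal n, g p) (∑' x, F x) := by
  have h1 : HasSum g (∑' x, F x) := hF.hasSum.prod_fiberwise hg
  have h2 := (Finset.HasAntidiagonal.sigmaAntidiagonalEquivProd (A := ℕ)).hasSum_iff.2 h1
  refine h2.sigma fun n => ?_
  have := hasSum_fintype fun p : Finset.HasAntidiagonal.antidiagonal n => g p
  rwa [Finset.sum_coe_sort _ g] at this

/-- The q-binomial theorem expands (abcq^n;q)_n over n = k + s, and Euler's theorem expands
(bq^n;q)_∞ over j. -/
theorem hasSum_extTerm {q : ℂ} (hq : ‖q‖ < 1) (c a b : ℂ) :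
    HasSum (extTerm q c a b) (∑' p, tripleTerm q c a b p) := by
  have hfib : ∀ p : ℕ × ℕ, HasSum (fun j => tripleTerm q c a b (p, j))
      (qPochInf q q * q ^ (p.1 + p.2) / (qPoch q q p.1 * qPoch q q p.2) *
        (-(a * b * c)) ^ p.1 * q ^ (p.1.choose 2 + (p.1 + p.2) * p.1) *
        qPochInf q (a * q ^ (p.1 + p.2)) * qPochInf q (b * q ^ (p.1 + p.2))) := fun p => by
    simp only [tripleTerm]
    exact (hasSum_eulerTerm hq (b * q ^ (p.1 + p.2))).mul_left _
  refine (hasSum_sum_antidiagonal (summable_tripleTerm hq c a b) hfib).congr_fun fun n => ?_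
  have hbin := prod_one_sub_eq_sum_gauss q n (a * b * c * q ^ n)
  have e1 : qPoch q (a * b * c * q ^ n) n = ∑ k ∈ Finset.range (n + 1),
      (gauss q n k * (-1) ^ k * q ^ k.choose 2) • (a * b * c * q ^ n) ^ k := by
    rw [← hbin, qPoch]
    exact Finset.prod_congr rfl fun l _ => by rw [smul_eq_mul, mul_comm (q ^ l)]
  have e2 : qPochInf q (q * q ^ n) = qPochInf q q / qPoch q q n := by
    rw [eq_div_iff (qPoch_self_ne_zero hq n), mul_comm, qPoch_mul_qPochInf hq]
  rw [extTerm, e1, e2, Finset.mul_sum, Finset.Nat.sum_antidiagonal_eq_sum_range_succ_mk]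
  refine Finset.sum_congr rfl fun k hk => ?_
  obtain ⟨s, rfl⟩ := Nat.exists_eq_add_of_le (show k ≤ n by simpa [Nat.lt_succ_iff] using hk)
  rw [Nat.add_sub_cancel_left, smul_eq_mul, gauss_add hq]
  have n1 := qPoch_self_ne_zero hq k
  have n2 := qPoch_self_ne_zero hq s
  have n3 := qPoch_self_ne_zero hq (k + s)
  rw [neg_pow (a * b * c), mul_pow (a * b * c), ← pow_mul, pow_add q (k.choose 2)]
  field_simp

/-- The absolutely convergent triple series is regrouped by the total power J = k + j of b: the sum
over s produces K_J(aq^k), and the sum over k is then the operator (cq²S;q)_J. -/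
theorem hasSum_expansion {q : ℂ} (hq : ‖q‖ < 1) (c a b : ℂ) :
    HasSum (fun J => (-b) ^ J * q ^ J.choose 2 * opPoch q (c * q ^ 2) J (kernelSum q J) a)
      (∑' n, extTerm q c a b n) := by
  rw [(hasSum_extTerm hq c a b).tsum_eq]
  -- Exchanges s and j, so that antidiagonals collect k + j = J instead of k + s = n.
  let e : (ℕ × ℕ) × ℕ ≃ (ℕ × ℕ) × ℕ :=
    { toFun := fun p => ((p.1.1, p.2), p.1.2)
      invFun := fun p => ((p.1.1, p.2), p.1.2)
      left_inv := fun _ => rfl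
      right_inv := fun _ => rfl }
  rw [← e.tsum_eq]
  have hs := e.summable_iff.2 (summable_tripleTerm hq c a b)
  refine (hasSum_sum_antidiagonal (F := fun p => tripleTerm q c a b (e p)) hs
    (g := fun p => (-b) ^ (p.1 + p.2) * q ^ (p.1 + p.2).choose 2 *
      (gauss q (p.1 + p.2) p.1 * (c * q ^ 2 * a) ^ p.1 * q ^ (2 * p.1.choose 2) *
        kernelSum q (p.1 + p.2) (a * q ^ p.1))) ?_).congr_fun fun J => ?_
  · rintro ⟨k, j⟩
    have h := (summable_kernelTerm hq (k + j) (a * q ^ k)).hasSum.mul_left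
      (qPochInf q q * q ^ k / (qPoch q q k * qPoch q q j) * (-(a * b * c)) ^ k *
        q ^ (k.choose 2 + k ^ 2) * ((-b) ^ j * q ^ (j.choose 2 + k * j)))
    have n1 := qPoch_self_ne_zero hq k
    have n2 := qPoch_self_ne_zero hq j
    have n3 := qPoch_self_ne_zero hq (k + j)
    have hval : (-b) ^ (k + j) * q ^ (k + j).choose 2 *
        (gauss q (k + j) k * (c * q ^ 2 * a) ^ k * q ^ (2 * k.choose 2) *
          kernelSum q (k + j) (a * q ^ k)) =
        qPochInf q q * q ^ k / (qPoch q q k * qPoch q q j) * (-(a * b * c)) ^ k *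
          q ^ (k.choose 2 + k ^ 2) * ((-b) ^ j * q ^ (j.choose 2 + k * j)) *
          ∑' s, kernelTerm q (k + j) (a * q ^ k) s := by
      rw [kernelSum, gauss_add hq, choose_two_add, sq_eq_add_two_mul_choose k,
        neg_pow (a * b * c), neg_pow b, neg_pow b j, pow_add (-1 : ℂ)]
      field_simp
      ring
    rw [← hval] at h
    refine h.congr_fun fun s => ?_
    have n4 := qPoch_self_ne_zero hq s
    simp only [e, Equiv.coe_fn_mk, tripleTerm, kernelTerm, eulerTerm]
    rw [mul_assoc a (q ^ k), ← pow_add, neg_pow b, neg_pow (b * q ^ (k + s))]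
    field_simp
    ring
  · rw [opPoch_apply, Finset.mul_sum, Finset.Nat.sum_antidiagonal_eq_sum_range_succ_mk]
    refine Finset.sum_congr rfl fun k hk => ?_
    obtain ⟨s, rfl⟩ := Nat.exists_eq_add_of_le (show k ≤ J by simpa [Nat.lt_succ_iff] using hk)
    simp only [Nat.add_sub_cancel_left]

/-! ### The entire extension of P_m and A -/

/-- The entire extension of `P` (with `c = 1 / q ^ m`), and of `AW` (with `c = 1 / q`). -/
noncomputable def extP (q c a b : ℂ) : ℂ := ∑' n, extTerm q c a b n

theorem extP_comm (q c a b : ℂ) : extP q c a b = extP q c b a := by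
  refine tsum_congr fun n => ?_
  rw [extTerm, extTerm, mul_comm b a]
  ring

/-- Weierstrass test: on a ball every factor of the n-th term other than q^n is bounded uniformly in
n. -/
theorem continuous_extP {q : ℂ} (hq : ‖q‖ < 1) (c : ℂ) :
    Continuous fun p : ℂ × ℂ => extP q c p.1 p.2 := by
  refine continuous_of_forall_ball fun r => ?_
  obtain ⟨B, hB0, hB⟩ := exists_qPochInf_le hq r
  obtain ⟨B', hB0', hB'⟩ := exists_qPochInf_le hq ‖q‖
  obtain ⟨D, hD⟩ := exists_qPoch_le hq (r * r * ‖c‖)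
  refine continuousOn_tsum (fun n => Continuous.continuousOn ?_)
    (((((summable_geometric_of_lt_one (norm_nonneg q) hq).mul_right B').mul_right B).mul_right
      B).mul_right D) fun n p hp => ?_
  · have := continuous_qPochInf hq
    unfold extTerm qPoch
    fun_prop
  · have hp' := (mem_ball_zero_iff.1 hp).le
    have h1 : ‖p.1‖ ≤ r := (norm_fst_le p).trans hp'
    have h2 : ‖p.2‖ ≤ r := (norm_snd_le p).trans hp'
    have hr : 0 ≤ r := (norm_nonneg _).trans h1
    rw [extTerm, norm_mul, norm_mul, norm_mul, norm_mul, norm_pow]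
    have h3 := hB' q le_rfl n
    have h4 := hB _ h1 n
    have h5 := hB _ h2 n
    have h6 := hD (p.1 * p.2 * c) (by rw [norm_mul, norm_mul]; gcongr) n n
    gcongr

/-- All denominators cancel through (x;q)_{2n} = (x;q)_n (xq^n;q)_n and (x;q)_∞ = (x;q)_n
(xq^n;q)_∞. -/
theorem mul_term_eq_extTerm {q : ℂ} (hq : ‖q‖ < 1) {m : ℕ} {a b : ℂ}
    (h : SeriesRegular q m a b) (n : ℕ) :
    qPochInf q q * qPochInf q a * qPochInf q b * term q m a b n =
      extTerm q (q ^ m)⁻¹ a b n := by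
  have n1 : qPoch q a n ≠ 0 := qPoch_ne_zero fun i _ => (h i).1
  have n2 : qPoch q b n ≠ 0 := qPoch_ne_zero fun i _ => (h i).2.1
  have n3 : qPoch q (a * b / q ^ m) n ≠ 0 := qPoch_ne_zero fun i _ => (h i).2.2
  have n4 := qPoch_self_ne_zero hq n
  rw [term, extTerm, ← div_eq_mul_inv, two_mul, qPoch_add, ← qPoch_mul_qPochInf hq q n,
    ← qPoch_mul_qPochInf hq a n, ← qPoch_mul_qPochInf hq b n]
  generalize qPoch q (a * b / q ^ m) n = W at *
  generalize qPoch q (a * b / q ^ m * q ^ n) n = Z at *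
  field_simp

theorem P_eq_extP {q : ℂ} (hq : ‖q‖ < 1) {m : ℕ} {a b : ℂ} (h : SeriesRegular q m a b) :
    P q m a b = extP q (q ^ m)⁻¹ a b := by
  rw [P, extP, ← tsum_mul_left]
  exact tsum_congr (mul_term_eq_extTerm hq h)

theorem summable_term {q : ℂ} (hq : ‖q‖ < 1) {m : ℕ} {a b : ℂ} (h : SeriesRegular q m a b) :
    Summable (term q m a b) := by
  have hne : qPochInf q q * qPochInf q a * qPochInf q b ≠ 0 :=
    mul_ne_zero (mul_ne_zero (qPochInf_self_ne_zero hq) (qPochInf_ne_zero hq fun i => (h i).1))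
      (qPochInf_ne_zero hq fun i => (h i).2.1)
  rw [← summable_mul_left_iff hne]
  simp only [mul_term_eq_extTerm hq h]
  exact (hasSum_extTerm hq _ a b).summable

theorem awTerm_eq_term (q a b : ℂ) : awTerm q a b = term q 1 a b := by
  ext n
  rw [awTerm, term, pow_one]

theorem AW_eq_P (q a b : ℂ) : AW q a b = P q 1 a b := by
  rw [AW, P, awTerm_eq_term]

theorem SeriesRegular.mul_pow {q : ℂ} {m : ℕ} {a b : ℂ} (h : SeriesRegular q m a b) (k : ℕ) :
    SeriesRegular q m (a * q ^ k) (b * q ^ k) := by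
  refine fun j => ⟨?_, ?_, ?_⟩
  · rw [mul_assoc, ← pow_add]
    exact (h _).1
  · rw [mul_assoc, ← pow_add]
    exact (h _).2.1
  · have := (h (k + k + j)).2.2
    rw [pow_add, pow_add] at this
    convert this using 1
    ring

theorem SeriesRegular.one {q : ℂ} (hq0 : q ≠ 0) {m : ℕ} (hm : 1 ≤ m) {a b : ℂ}
    (h : SeriesRegular q m a b) : SeriesRegular q 1 a b := by
  refine fun j => ⟨(h j).1, (h j).2.1, ?_⟩
  obtain ⟨p, rfl⟩ := Nat.exists_eq_add_of_le hm
  have := (h (p + j)).2.2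
  convert this using 1
  field_simp
  ring

/-! ### Partial theta functions and the product formula -/

/-- The partial theta function `∑_J (-b)^J q^{J(J-1)/2}`. -/
noncomputable def partialTheta (q b : ℂ) : ℂ := ∑' J : ℕ, (-b) ^ J * q ^ J.choose 2

theorem hasSum_partialTheta {q : ℂ} (hq : ‖q‖ < 1) (b : ℂ) :
    HasSum (fun J : ℕ => (-b) ^ J * q ^ J.choose 2) (partialTheta q b) := by
  refine Summable.hasSum (.of_norm_bounded
    (summable_pow_mul_pow_choose (norm_nonneg q) hq ‖b‖) fun J => ?_)
  rw [norm_mul, norm_pow, norm_pow, norm_neg]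

theorem partialTheta_zero (q : ℂ) : partialTheta q 0 = 1 := by
  rw [partialTheta, tsum_eq_single 0 fun J hJ => by simp [hJ]]
  simp

/-- The Andrews-Warnaar identity. -/
theorem extP_inv_eq {q : ℂ} (hq0 : q ≠ 0) (hq : ‖q‖ < 1) (a b : ℂ) :
    extP q q⁻¹ a b = partialTheta q a * partialTheta q b := by
  have h1 : ∀ a b, extP q q⁻¹ a b = kernelSum q 0 a * partialTheta q b := by
    intro a b
    have h := hasSum_expansion hq q⁻¹ a b
    have e : q⁻¹ * q ^ 2 = q := by field_simp
    simp only [e, opPoch_self_kernelSum hq] at h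
    rw [mul_comm]
    exact h.unique ((hasSum_partialTheta hq b).mul_right _)
  have h2 : kernelSum q 0 0 = 1 := by
    simpa [opPoch_one_apply] using congrFun (kernelSum_zero hq) 0
  -- Symmetry at b = 0 compares K_0(a) θ(0) with K_0(0) θ(a), where θ(0) = K_0(0) = 1.
  have h3 : kernelSum q 0 a = partialTheta q a := by
    have := extP_comm q q⁻¹ a 0
    rwa [h1, h1, partialTheta_zero, h2, mul_one, one_mul] at this
  rw [h1, h3]

theorem opPoch_apply_one (q c x a : ℂ) (N : ℕ) (hx : x * q = c * a) :
    opPoch q c N 1 a = stieltjesWigert q N x := by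
  rw [opPoch_apply, stieltjesWigert]
  refine Finset.sum_congr rfl fun k _ => ?_
  rw [← hx, sq_eq_add_two_mul_choose, Pi.one_apply]
  ring

theorem coeff_eq_gauss {q : ℂ} (hq : ‖q‖ < 1) {M k : ℕ} (hk : k ≤ M) (x : ℂ) :
    coeff q (M + 1) x k = gauss q M k * (x * q ^ ((k : ℤ) - (M + 1 : ℕ) + 1)) ^ k := by
  obtain ⟨p, rfl⟩ := Nat.exists_eq_add_of_le hk
  have e : q ^ (((k + p + 1 : ℕ) : ℤ) - k) = q * q ^ p := by
    rw [← pow_succ', ← zpow_natCast]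
    congr 1
    push_cast
    ring
  have n1 := qPoch_self_ne_zero hq p
  have n2 := qPoch_self_ne_zero hq k
  rw [coeff, gauss_add hq, e, add_comm k p, qPoch_add]
  field_simp

/-- The weights are those of a q-factorial in S of length N + 1, which completes each J-th operator
to one containing (S;q)_{J+1}; that factor reduces K_J to 1, so the J-dependence is left only in the
theta series. -/
theorem sum_coeff_mul_extP {q : ℂ} (hq0 : q ≠ 0) (hq : ‖q‖ < 1) (N : ℕ) (a b : ℂ) :
    ∑ k ∈ Finset.range (N + 2),
        coeff q (N + 2) a k * extP q (q ^ (N + 2))⁻¹ (a * q ^ k) (b * q ^ k) =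
      stieltjesWigert q N (a * q ^ ((1 : ℤ) - (N + 2 : ℕ))) * partialTheta q b := by
  set c := (q ^ (N + 2))⁻¹ * q ^ 2 with hc
  have hcN : c * q ^ N = 1 := by
    rw [hc, pow_add]
    field_simp
  have h1 : HasSum (fun J : ℕ => ∑ k ∈ Finset.range (N + 2), coeff q (N + 2) a k *
      ((-(b * q ^ k)) ^ J * q ^ J.choose 2 * opPoch q c J (kernelSum q J) (a * q ^ k)))
      (∑ k ∈ Finset.range (N + 2),
        coeff q (N + 2) a k * extP q (q ^ (N + 2))⁻¹ (a * q ^ k) (b * q ^ k)) :=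
    hasSum_sum fun k _ => (hasSum_expansion hq _ (a * q ^ k) (b * q ^ k)).mul_left _
  refine h1.unique (((hasSum_partialTheta hq b).mul_left _).congr_fun fun J => ?_)
  -- As cq^N = 1, both (cS;q)_J (cq^J S;q)_{N+1} and (cS;q)_N (S;q)_{J+1} equal (cS;q)_{J+N+1}.
  have hop : opPoch q (c * q ^ J) (N + 1) (opPoch q c J (kernelSum q J)) =
      opPoch q c N 1 := by
    rw [← opPoch_kernelSum hq J, ← Module.End.mul_apply, ← Module.End.mul_apply, ← hcN,
      ← opPoch_add, opPoch_commute, ← opPoch_add, add_left_comm]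
  have hx : a * q ^ ((1 : ℤ) - (N + 2 : ℕ)) * q = c * a := by
    have : q ^ ((1 : ℤ) - (N + 2 : ℕ)) = q * (q ^ (N + 2))⁻¹ := by
      rw [zpow_sub₀ hq0, zpow_one, zpow_natCast, div_eq_mul_inv]
    rw [this, hc]
    ring
  rw [← opPoch_apply_one q c _ a N hx, ← hop, opPoch_apply, Finset.sum_mul]
  refine Finset.sum_congr rfl fun k hk => ?_
  have hk' : k ≤ N + 1 := by simpa [Nat.lt_succ_iff] using hk
  have e : q ^ ((k : ℤ) - (N + 1 + 1 : ℕ) + 1) = q ^ k * (q ^ (N + 1))⁻¹ := by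
    rw [← zpow_natCast, ← zpow_natCast, ← zpow_neg, ← zpow_add₀ hq0]
    congr 1
    push_cast
    ring
  -- The factor q^{kJ} coming from (bq^k)^J shifts the parameter of the operator from c to cq^J.
  have e2 : (a * (q ^ k * (q ^ (N + 1))⁻¹)) ^ k * (q ^ k) ^ J =
      (c * q ^ J * a) ^ k * q ^ (2 * k.choose 2) := by
    have h2 : c = (q ^ (N + 1))⁻¹ * q := by
      rw [hc]
      field_simp
      ring
    have h3 := congrArg (q ^ ·) (sq_eq_add_two_mul_choose k)
    simp only [pow_add] at h3
    rw [h2, mul_pow, mul_pow, mul_pow, mul_pow, mul_pow, ← pow_mul, ← sq, h3]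
    ring
  rw [show N + 2 = N + 1 + 1 from rfl, coeff_eq_gauss hq hk', e, neg_mul_eq_neg_mul,
    mul_pow (-b)]
  generalize opPoch q c J (kernelSum q J) (a * q ^ k) = W
  linear_combination (gauss q (N + 1) k * (-b) ^ J * q ^ J.choose 2 * W) * e2

theorem product_formula {q : ℂ} (hq0 : q ≠ 0) (hq : ‖q‖ < 1) (N : ℕ) (a b : ℂ) :
    (∑ k ∈ Finset.range (N + 2),
        coeff q (N + 2) a k * extP q (q ^ (N + 2))⁻¹ (a * q ^ k) (b * q ^ k)) *
      (∑ k ∈ Finset.range (N + 2),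
        coeff q (N + 2) b k * extP q (q ^ (N + 2))⁻¹ (a * q ^ k) (b * q ^ k)) =
      stieltjesWigert q N (a * q ^ ((1 : ℤ) - (N + 2 : ℕ))) *
        stieltjesWigert q N (b * q ^ ((1 : ℤ) - (N + 2 : ℕ))) * extP q q⁻¹ a b := by
  have h := sum_coeff_mul_extP hq0 hq N b a
  simp only [extP_comm q _ (b * _)] at h
  rw [sum_coeff_mul_extP hq0 hq, h, extP_inv_eq hq0 hq]
  ring

end PartialTheta

/-- The product formula: first as it is written, wherever no denominator vanishes; then for all
complex `a`, `b`, with every factor replaced by its continuous extension. The extensions `P'`, `A'`,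
`Q'` are unique, as the sets on which they are prescribed are dense. -/
theorem mainTheorem3 (q : ℂ) (hq0 : q ≠ 0) (hq1 : ‖q‖ < 1) (m : ℕ) (hm : 2 ≤ m) :
    (∀ a b : ℂ, PartialTheta.SeriesRegular q m a b →
      PartialTheta.QRegular q m (a * q ^ ((1 : ℤ) - m)) →
      PartialTheta.QRegular q m (b * q ^ ((1 : ℤ) - m)) →
      (∀ k ∈ Finset.range m, Summable (PartialTheta.term q m (a * q ^ k) (b * q ^ k))) ∧
      Summable (PartialTheta.awTerm q a b) ∧
      (∑ k ∈ Finset.range m,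
          PartialTheta.coeff q m a k * PartialTheta.P q m (a * q ^ k) (b * q ^ k)) *
        (∑ k ∈ Finset.range m,
          PartialTheta.coeff q m b k * PartialTheta.P q m (a * q ^ k) (b * q ^ k)) =
      PartialTheta.Q q m (a * q ^ ((1 : ℤ) - m)) * PartialTheta.Q q m (b * q ^ ((1 : ℤ) - m)) *
        PartialTheta.AW q a b) ∧
    (∃ (P' A' : ℂ × ℂ → ℂ) (Q' : ℂ → ℂ),
      Continuous P' ∧ Continuous A' ∧ Continuous Q' ∧
      (∀ a b : ℂ, PartialTheta.SeriesRegular q m a b → P' (a, b) = PartialTheta.P q m a b) ∧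
      (∀ a b : ℂ, PartialTheta.SeriesRegular q 1 a b → A' (a, b) = PartialTheta.AW q a b) ∧
      (∀ b : ℂ, PartialTheta.QRegular q m b → Q' b = PartialTheta.Q q m b) ∧
      ∀ a b : ℂ,
        (∑ k ∈ Finset.range m, PartialTheta.coeff q m a k * P' (a * q ^ k, b * q ^ k)) *
          (∑ k ∈ Finset.range m, PartialTheta.coeff q m b k * P' (a * q ^ k, b * q ^ k)) =
        Q' (a * q ^ ((1 : ℤ) - m)) * Q' (b * q ^ ((1 : ℤ) - m)) * A' (a, b)) := by

  obtain ⟨N, rfl⟩ := Nat.exists_eq_add_of_le' hm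
  -- The extensions are the denominator-free series with c = q^{-m} and c = q^{-1}, and the
  -- Stieltjes-Wigert polynomial; the identity as written is their product formula restricted to
  -- regular parameters.
  refine ⟨fun a b h hQa hQb => ⟨fun k _ => PartialTheta.summable_term hq1 (h.mul_pow k), ?_, ?_⟩,
    fun p => PartialTheta.extP q (q ^ (N + 2))⁻¹ p.1 p.2,
    fun p => PartialTheta.extP q q⁻¹ p.1 p.2, PartialTheta.stieltjesWigert q N,
    PartialTheta.continuous_extP hq1 _, PartialTheta.continuous_extP hq1 _, ?_,
    fun a b h => (PartialTheta.P_eq_extP hq1 h).symm, fun a b h => ?_,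
    fun b h => (PartialTheta.Q_eq_stieltjesWigert hq0 hq1 h).symm,
    fun a b => PartialTheta.product_formula hq0 hq1 N a b⟩
  · rw [PartialTheta.awTerm_eq_term]
    exact PartialTheta.summable_term hq1 (h.one hq0 (by omega))
  · simp only [PartialTheta.P_eq_extP hq1 (h.mul_pow _)]
    rw [PartialTheta.Q_eq_stieltjesWigert hq0 hq1 hQa, PartialTheta.Q_eq_stieltjesWigert hq0 hq1 hQb,
      PartialTheta.AW_eq_P, PartialTheta.P_eq_extP hq1 (h.one hq0 (by omega)), pow_one]
    exact PartialTheta.product_formula hq0 hq1 N a b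
  · unfold PartialTheta.stieltjesWigert
    fun_prop
  · rw [PartialTheta.AW_eq_P, PartialTheta.P_eq_extP hq1 h, pow_one]
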